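/- **Setting.** $T$ divisible items arrive one per round and are divided between two agents. Agent $i\in\{1,2\}$ has value $v_{it}\ge 0$ for item $t$, with $\sum_{t=1}^T v_{it}=1$. An allocation $x$ is feasible if $x_{it}\ge 0$ and $x_{1t}+x_{2t}\le 1$ for all $t$; agent $i$'s utility is $u_i(x)=\sum_t v_{it}x_{it}$, and the social welfare is $SW(x)=u_1(x)+u_2(x)$. When item $t$ arrives, its values $v_{1t},v_{2t}$ are revealed and the item has to be divided irrevocably; the number $T$ is not known to the algorithm. **Algorithm.** The *guarded poly-proportional algorithm* with parameter $p>0$ works as follows. As long as no agent has reached a critical point, item $t$ is divided poly-proportionally: agent $i$ gets the fraction $q_{it}=v_{it}^p/(v_{1t}^p+v_{2t}^p)$ (and nothing is allocated if $v_{1t}=v_{2t}=0$). Each item is divided continuously: after a fraction $f\in[0,1]$ of item $t$ has been divided, agent $i$ has received $f q_{it}$ of it, and agent $i$ is at a *critical point* if $$\sum_{s<t} v_{is}x_{is}+f\,q_{it}v_{it}+(1-f)v_{it}+\sum_{s>t}v_{is}=\tfrac12 ,$$ that is, if the utility received so far plus the value of everything that is left is exactly $\tfrac12$ (by normalization, $\sum_{s>t}v_{is}=1-\sum_{s\le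 t}v_{is}$ is known in round $t$). At the first moment at which some agent reaches a critical point, the remaining fraction $1-f$ of the current item and all later items are given entirely to that agent (if both agents reach one at the same moment, to agent $1$). **Theorem.** For $p=2.7$ the guarded poly-proportional algorithm achieves a $0.916$ approximation to the optimal social welfare: for every $T$ and every pair of normalized valuations $v$ as above, the allocation $x$ that it outputs is feasible and satisfies $$\frac{SW(x)}{\max\{SW(y): y \text{ a feasible allocation}\}}\ \ge\ 0.916 .$$ -/

import Mathlib

noncomputable section

namespace OnlineDivision

/-- `v i t` is the value of agent `i` for item `t`; values are nonnegative and each agent's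
values add up to one. -/
def IsInstance {T : ℕ} (v : Fin 2 → Fin T → ℝ) : Prop :=
  (∀ i t, 0 ≤ v i t) ∧ ∀ i, ∑ t, v i t = 1

/-- `x i t` is the fraction of item `t` given to agent `i`. -/
def IsFeasible {T : ℕ} (x : Fin 2 → Fin T → ℝ) : Prop :=
  (∀ i t, 0 ≤ x i t) ∧ ∀ t, ∑ i, x i t ≤ 1

/-- The (additive) utility of agent `i` for the allocation `x`. -/
def utility {T : ℕ} (v x : Fin 2 → Fin T → ℝ) (i : Fin 2) : ℝ := ∑ t, v i t * x i t

def socialWelfare {T : ℕ} (v x : Fin 2 → Fin T → ℝ) : ℝ := ∑ i, utility v x i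

/-- The largest social welfare of a feasible allocation. -/
def optWelfare {T : ℕ} (v : Fin 2 → Fin T → ℝ) : ℝ :=
  sSup {w | ∃ x : Fin 2 → Fin T → ℝ, IsFeasible x ∧ w = socialWelfare v x}

/-- A deterministic online algorithm for two agents. It keeps a state; when an item arrives, the
fractions handed to the two agents are computed from the state and from the agents' values for
this item, and the state is updated. The number of rounds is not an input. -/
structure OnlineAlgorithm where
  State : Type
  start : State
  allocate : State → (Fin 2 → ℝ) → (Fin 2 → ℝ)
  update : State → (Fin 2 → ℝ) → State

/-- The state at the beginning of round `k` (rounds are numbered from `0`). -/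
def OnlineAlgorithm.stateAt (A : OnlineAlgorithm) {T : ℕ} (v : Fin 2 → Fin T → ℝ) : ℕ → A.State
  | 0 => A.start
  | k + 1 =>
    if h : k < T then A.update (A.stateAt v k) (fun i => v i ⟨k, h⟩) else A.stateAt v k

/-- The allocation that the algorithm outputs on the values `v`. -/
def OnlineAlgorithm.output (A : OnlineAlgorithm) {T : ℕ} (v : Fin 2 → Fin T → ℝ) :
    Fin 2 → Fin T → ℝ :=
  fun i t => A.allocate (A.stateAt v t) (fun j => v j t) i

/-- On every normalized instance, with any number of items, the algorithm outputs a feasible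
allocation whose social welfare is at least `α` times the optimal one. -/
def OnlineAlgorithm.IsApproximation (A : OnlineAlgorithm) (α : ℝ) : Prop :=
  ∀ (T : ℕ) (v : Fin 2 → Fin T → ℝ), IsInstance v →
    IsFeasible (A.output v) ∧ α ≤ socialWelfare v (A.output v) / optWelfare v

/-- The fraction of an item with values `a` that the poly-proportional rule gives to agent `i`.
(It is `0` for both agents if nobody values the item and `p ≠ 0`.) -/
def polyShare (p : ℝ) (a : Fin 2 → ℝ) (i : Fin 2) : ℝ := a i ^ p / ∑ j, a j ^ p

/-- What the guarded algorithm remembers: the utilities received so far, the agents' total values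
for the items that have not arrived yet, and the agent (if any) that reached a critical point. -/
structure GuardState where
  received : Fin 2 → ℝ
  remaining : Fin 2 → ℝ
  guarded : Option (Fin 2)

/-- The fractions `f` of the arriving item (with values `a`) such that agent `i` is at a critical
point once a fraction `f` of that item has been divided by the poly-proportional rule: the utility
received up to then plus the value of all that is left is exactly `1 / 2`. -/
def criticalFractions (p : ℝ) (s : GuardState) (a : Fin 2 → ℝ) (i : Fin 2) : Set ℝ :=
  {f | 0 ≤ f ∧ f ≤ 1 ∧
    (s.received i + f * polyShare p a i * a i) + ((1 - f) * a i + (s.remaining i - a i)) = 1 / 2}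

/-- The point of the round at which agent `i` reaches a critical point
(used only when there is one). -/
def criticalTime (p : ℝ) (s : GuardState) (a : Fin 2 → ℝ) (i : Fin 2) : ℝ :=
  sInf (criticalFractions p s a i)

open Classical in
/-- The agent that is the first to reach a critical point in this round, if there is one; a tie is
broken in favour of agent `0`. -/
def newlyGuarded (p : ℝ) (s : GuardState) (a : Fin 2 → ℝ) : Option (Fin 2) :=
  if (criticalFractions p s a 0).Nonempty ∧
      ((criticalFractions p s a 1).Nonempty → criticalTime p s a 0 ≤ criticalTime p s a 1) then
    some 0
  else if (criticalFractions p s a 1).Nonempty then some 1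
  else none

/-- The division of an arriving item with values `a`. If an agent has reached a critical point
before, this agent gets the item. Otherwise the item is divided by the poly-proportional rule,
up to the moment (if any) at which an agent reaches a critical point; what is left of the item
then goes to this agent. -/
def guardedAllocate (p : ℝ) (s : GuardState) (a : Fin 2 → ℝ) (j : Fin 2) : ℝ :=
  match s.guarded with
  | some i => if j = i then 1 else 0
  | none =>
    match newlyGuarded p s a with
    | some i =>
      criticalTime p s a i * polyShare p a j + if j = i then 1 - criticalTime p s a i else 0
    | none => polyShare p a j

def guardedUpdate (p : ℝ) (s : GuardState) (a : Fin 2 → ℝ) : GuardState where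
  received := fun j => s.received j + guardedAllocate p s a j * a j
  remaining := fun j => s.remaining j - a j
  guarded :=
    match s.guarded with
    | some i => some i
    | none => newlyGuarded p s a

/-- The guarded poly-proportional algorithm with parameter `p`. At the start nothing has been
received, and the remaining value of each agent is the normalized total `1`. -/
def guardedPolyProportional (p : ℝ) : OnlineAlgorithm where
  State := GuardState
  start := { received := fun _ => 0, remaining := fun _ => 1, guarded := none }
  allocate := guardedAllocate p
  update := guardedUpdate p

end OnlineDivision

end

/-! Let c = 0.916. After some rounds let u_j be the utility received by agent j, V_j the value j has
seen, and M the sum of the larger values of the past items, which bounds their optimal welfare. Two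
inequalities hold item by item under poly-proportional division (`share_bounds`) and add up: c M ≤
u_0 + u_1, which settles runs without a critical point, and (3c - 1)(V_i - u_i) ≤ u_j + c (u_i + V_j
- M) for j ≠ i. At a critical point of i the loss V_i - u_i is 1/2. From then on i receives
everything, and the right side cannot decrease because the larger value of an item is at most the
sum of both. At the end u_i = 1/2 and V_j = 1, and the inequality reads c M ≤ u_0 + u_1 again. By
homogeneity the item-wise inequalities involve only the ratio of the two values. They reduce to
`rpow_mul_sub_le` (almost tight), `mul_rpow_le_rpow` and `mul_le_one_add_rpow`. -/

namespace OnlineDivision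

/-! ### One-variable inequalities -/

/-- Weighted AM-GM for 1 and t ^ b, with equality at t = 1. Substituting r = r₀ t reduces each
inequality below to a numerical bound at r₀. -/
lemma rpow_le_affine_rpow {a b t : ℝ} (ha : 0 ≤ a) (hab : a ≤ b) (hb : 0 < b) (ht : 0 ≤ t) :
    t ^ a ≤ (1 - a / b) + a / b * t ^ b := by
  have h := Real.geom_mean_le_arith_mean2_weighted (w₁ := 1 - a / b) (w₂ := a / b) (p₁ := 1)
    (p₂ := t ^ b) (by rw [sub_nonneg, div_le_one hb]; exact hab) (by positivity) zero_le_one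
    (by positivity) (by ring)
  rwa [Real.one_rpow, one_mul, mul_one, ← Real.rpow_mul ht, mul_div_cancel₀ a hb.ne'] at h

/-- Trades the exponent m / n for integer powers, which `norm_num` can evaluate. -/
lemma rpow_le_of_pow_le {x c q : ℝ} {m n : ℕ} (hx : 0 ≤ x) (hc : 0 ≤ c) (hn : n ≠ 0)
    (hq : q * n = m) (h : x ^ m ≤ c ^ n) : x ^ q ≤ c := by
  refine le_of_pow_le_pow_left₀ hn hc ?_
  rwa [← Real.rpow_natCast, ← Real.rpow_mul hx, hq, Real.rpow_natCast]

lemma le_rpow_of_pow_le {x c q : ℝ} {m n : ℕ} (hx : 0 ≤ x) (hn : n ≠ 0)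
    (hq : q * n = m) (h : c ^ n ≤ x ^ m) : c ≤ x ^ q := by
  refine le_of_pow_le_pow_left₀ hn (by positivity) ?_
  rwa [← Real.rpow_natCast (x ^ q), ← Real.rpow_mul hx, hq, Real.rpow_natCast]

lemma rpow_mul_sub_le {r : ℝ} (hr : 0 ≤ r) :
    r ^ (2.7 : ℝ) * (0.916 - r) ≤ 0.084 := by
  -- The maximizer of the left side: with it the t ^ 3.7 terms cancel, and the bound 0.3393 leaves
  -- almost no slack.
  set r₀ : ℝ := 0.916 * 27 / 37 with hr₀
  have h₀ : 0 < r₀ := by norm_num [hr₀]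
  obtain ⟨t, ht, rfl⟩ : ∃ t, 0 ≤ t ∧ r = r₀ * t := ⟨r / r₀, by positivity, by field_simp⟩
  have hc : r₀ ^ (2.7 : ℝ) ≤ 0.3393 :=
    rpow_le_of_pow_le (m := 27) (n := 10) h₀.le (by norm_num) (by norm_num) (by norm_num)
      (by norm_num [hr₀])
  have hc0 : 0 ≤ r₀ ^ (2.7 : ℝ) := by positivity
  have key := rpow_le_affine_rpow (a := 2.7) (b := 3.7) (by norm_num) (by norm_num)
    (by norm_num) ht
  have hT : t ^ (3.7 : ℝ) = t ^ (2.7 : ℝ) * t := by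
    rw [← Real.rpow_add_one' ht (by norm_num)]; norm_num
  rw [hT] at key
  rw [Real.mul_rpow h₀.le ht]
  have h2 := mul_le_mul_of_nonneg_left key hc0
  norm_num [hr₀] at h2 hc ⊢
  linarith

lemma mul_rpow_le_rpow {r : ℝ} (hr : 0 ≤ r) :
    2.664 * r ^ (1.7 : ℝ) ≤ 0.916 + 1.916 * r ^ (2.7 : ℝ) := by
  -- Chosen so that the t ^ 2.7 terms cancel.
  set r₀ : ℝ := 2.664 * 17 / 27 / 1.916 with hr₀
  have h₀ : 0 < r₀ := by norm_num [hr₀]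
  obtain ⟨t, ht, rfl⟩ : ∃ t, 0 ≤ t ∧ r = r₀ * t := ⟨r / r₀, by positivity, by field_simp⟩
  have hc : r₀ ^ (1.7 : ℝ) ≤ 0.8 :=
    rpow_le_of_pow_le (m := 17) (n := 10) h₀.le (by norm_num) (by norm_num) (by norm_num)
      (by norm_num [hr₀])
  have hc0 : 0 ≤ r₀ ^ (1.7 : ℝ) := by positivity
  have key := rpow_le_affine_rpow (a := 1.7) (b := 2.7) (by norm_num) (by norm_num)
    (by norm_num) ht
  have hc2 : r₀ ^ (2.7 : ℝ) = r₀ ^ (1.7 : ℝ) * r₀ := by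
    rw [← Real.rpow_add_one' h₀.le (by norm_num)]; norm_num
  rw [Real.mul_rpow h₀.le ht, Real.mul_rpow h₀.le ht, hc2]
  have h2 := mul_le_mul_of_nonneg_left key hc0
  norm_num [hr₀] at h2 hc ⊢
  linarith

lemma mul_le_one_add_rpow {s : ℝ} (hs : 0 ≤ s) :
    1.748 * s ≤ 1 + 0.916 * s ^ (3.7 : ℝ) := by
  -- Chosen so that the constant term after AM-GM is exactly 1; the coefficient of t ^ 3.7 is then
  -- 10 / 27.
  set r₀ : ℝ := 37 / (27 * 1.748) with hr₀
  have h₀ : 0 < r₀ := by norm_num [hr₀]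
  obtain ⟨t, ht, rfl⟩ : ∃ t, 0 ≤ t ∧ s = r₀ * t := ⟨s / r₀, by positivity, by field_simp⟩
  have hc : 10 / 27 / 0.916 ≤ r₀ ^ (3.7 : ℝ) :=
    le_rpow_of_pow_le (m := 37) (n := 10) h₀.le (by norm_num) (by norm_num)
      (by norm_num [hr₀])
  have key := rpow_le_affine_rpow (a := 1) (b := 3.7) (by norm_num) (by norm_num)
    (by norm_num) ht
  rw [Real.rpow_one] at key
  rw [Real.mul_rpow h₀.le ht]
  have hT : 0 ≤ t ^ (3.7 : ℝ) := by positivity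
  have h2 := mul_le_mul_of_nonneg_right hc hT
  norm_num [hr₀] at h2 key ⊢
  linarith

/-! ### Shares of one item -/

lemma polyShare_nonneg {p : ℝ} {a : Fin 2 → ℝ} (ha : ∀ i, 0 ≤ a i) (i : Fin 2) :
    0 ≤ polyShare p a i :=
  div_nonneg (Real.rpow_nonneg (ha i) p)
    (Finset.sum_nonneg fun j _ => Real.rpow_nonneg (ha j) p)

lemma sum_polyShare_le_one (p : ℝ) (a : Fin 2 → ℝ) : ∑ i, polyShare p a i ≤ 1 := by
  simp only [polyShare, ← Finset.sum_div]
  exact div_self_le_one _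

lemma polyShare_swap (p : ℝ) (a : Fin 2 → ℝ) (i : Fin 2) :
    polyShare p (fun j => a j.rev) i = polyShare p a i.rev := by
  fin_cases i <;> simp [polyShare, Fin.rev, add_comm]

/-- Shares of an item in terms of the ratio of the smaller to the larger value. -/
lemma polyShare_eq_of_ratio {a : Fin 2 → ℝ} {p r : ℝ} (h0 : 0 < a 0) (hr : 0 ≤ r)
    (h1 : a 1 = a 0 * r) :
    polyShare p a 0 = 1 / (1 + r ^ p) ∧ polyShare p a 1 = r ^ p / (1 + r ^ p) := by
  have : 0 < a 0 ^ p := by positivity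
  have : 0 < 1 + r ^ p := by positivity
  simp only [polyShare, Fin.sum_univ_two, h1, Real.mul_rpow h0.le hr]
  constructor <;> field_simp

/-- With r = a 1 / a 0, the three parts are a 0 / (1 + r ^ 2.7) times the one-variable inequalities,
the second of them multiplied by r. -/
lemma share_bounds_of_le {a : Fin 2 → ℝ} (ha : ∀ i, 0 ≤ a i) (h : a 1 ≤ a 0) :
    0.916 * a 0 ≤ polyShare 2.7 a 0 * a 0 + polyShare 2.7 a 1 * a 1 ∧
    1.748 * (a 0 - polyShare 2.7 a 0 * a 0) ≤
      polyShare 2.7 a 1 * a 1 + 0.916 * (polyShare 2.7 a 0 * a 0 + a 1 - a 0) ∧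
    1.748 * (a 1 - polyShare 2.7 a 1 * a 1) ≤
      polyShare 2.7 a 0 * a 0 + 0.916 * (polyShare 2.7 a 1 * a 1 + a 0 - a 0) := by
  rcases (ha 0).eq_or_lt with h0 | h0
  · have h1 : a 1 = 0 := le_antisymm (h0 ▸ h) (ha 1)
    simp [← h0, h1]
  obtain ⟨r, hr, h1⟩ : ∃ r, 0 ≤ r ∧ a 1 = a 0 * r :=
    ⟨a 1 / a 0, div_nonneg (ha 1) h0.le, by field_simp⟩
  obtain ⟨e0, e1⟩ := polyShare_eq_of_ratio (p := 2.7) h0 hr h1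
  have hz : 0 ≤ r ^ (2.7 : ℝ) := by positivity
  have i1 := rpow_mul_sub_le hr
  have i2 := mul_rpow_le_rpow hr
  have i3 := mul_le_one_add_rpow hr
  have z2 : r ^ (2.7 : ℝ) = r ^ (1.7 : ℝ) * r := by
    rw [← Real.rpow_add_one' hr (by norm_num)]; norm_num
  have z3 : r ^ (3.7 : ℝ) = r ^ (2.7 : ℝ) * r := by
    rw [← Real.rpow_add_one' hr (by norm_num)]; norm_num
  rw [z3] at i3
  have i2' : 2.664 * r ^ (2.7 : ℝ) ≤ 0.916 * r + 1.916 * r ^ (2.7 : ℝ) * r := by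
    nlinarith [mul_le_mul_of_nonneg_right i2 hr]
  rw [e0, e1, h1]
  generalize r ^ (2.7 : ℝ) = z at *
  have hD : 0 < 1 + z := by positivity
  have k : 0 ≤ a 0 / (1 + z) := by positivity
  refine ⟨?_, ?_, ?_⟩ <;> rw [← sub_nonneg]
  · refine (mul_nonneg k (sub_nonneg.2 i1)).trans_eq ?_
    field_simp; ring
  · refine (mul_nonneg k (sub_nonneg.2 i2')).trans_eq ?_
    field_simp; ring
  · refine (mul_nonneg k (sub_nonneg.2 i3)).trans_eq ?_
    field_simp; ring

lemma share_bounds {a : Fin 2 → ℝ} (ha : ∀ i, 0 ≤ a i) :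
    0.916 * max (a 0) (a 1) ≤ polyShare 2.7 a 0 * a 0 + polyShare 2.7 a 1 * a 1 ∧
    ∀ i : Fin 2, 1.748 * (a i - polyShare 2.7 a i * a i) ≤ polyShare 2.7 a i.rev * a i.rev +
      0.916 * (polyShare 2.7 a i * a i + a i.rev - max (a 0) (a 1)) := by
  rcases le_total (a 1) (a 0) with h | h
  · obtain ⟨h1, h2, h3⟩ := share_bounds_of_le ha h
    rw [max_eq_left h]
    refine ⟨h1, fun i => ?_⟩
    fin_cases i
    exacts [h2, h3]
  · obtain ⟨h1, h2, h3⟩ := share_bounds_of_le (a := fun j => a j.rev) (fun i => ha _) h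
    simp only [polyShare_swap] at h1 h2 h3
    rw [max_eq_right h]
    refine ⟨(h1.trans_eq (add_comm _ _)), fun i => ?_⟩
    fin_cases i
    exacts [h3, h2]

/-! ### The critical moment -/

/-- The set is closed and bounded below, so its infimum is attained. -/
lemma criticalTime_mem {p : ℝ} {s : GuardState} {a : Fin 2 → ℝ} {i : Fin 2}
    (h : (criticalFractions p s a i).Nonempty) :
    criticalTime p s a i ∈ criticalFractions p s a i := by
  refine IsClosed.csInf_mem ?_ h ⟨0, fun f hf => hf.1⟩
  refine (isClosed_le continuous_const continuous_id).inter
    ((isClosed_le continuous_id continuous_const).inter (isClosed_eq ?_ continuous_const))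
  fun_prop

lemma criticalTime_mem_of_newlyGuarded {p : ℝ} {s : GuardState} {a : Fin 2 → ℝ} {i : Fin 2}
    (h : newlyGuarded p s a = some i) : criticalTime p s a i ∈ criticalFractions p s a i := by
  apply criticalTime_mem
  unfold newlyGuarded at h
  split_ifs at h with h0 h1
  · exact Option.some.inj h ▸ h0.1
  · exact Option.some.inj h ▸ h1

lemma guardedAllocate_nonneg {p : ℝ} {s : GuardState} {a : Fin 2 → ℝ} (ha : ∀ i, 0 ≤ a i)
    (j : Fin 2) : 0 ≤ guardedAllocate p s a j := by
  unfold guardedAllocate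
  split
  · split_ifs <;> norm_num
  · split
    · rename_i i hi
      obtain ⟨h0, h1, -⟩ := criticalTime_mem_of_newlyGuarded hi
      have := mul_nonneg h0 (polyShare_nonneg (p := p) ha j)
      split_ifs <;> linarith
    · exact polyShare_nonneg ha j

lemma sum_guardedAllocate_le_one (p : ℝ) (s : GuardState) (a : Fin 2 → ℝ) :
    ∑ j, guardedAllocate p s a j ≤ 1 := by
  unfold guardedAllocate
  split
  · simp
  · split
    · rename_i i hi
      obtain ⟨h0, h1, -⟩ := criticalTime_mem_of_newlyGuarded hi
      have := mul_le_mul_of_nonneg_left (sum_polyShare_le_one p a) h0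
      rw [Finset.sum_add_distrib, ← Finset.mul_sum, Finset.sum_ite_eq' Finset.univ i,
        if_pos (Finset.mem_univ i)]
      linarith
    · exact sum_polyShare_le_one p a

/-! ### The invariant -/

/-- The bound on the welfare lost so far, `M` being the optimal welfare of the past items. -/
def WelfareBound (s : GuardState) (M : ℝ) : Prop :=
  match s.guarded with
  | none => 0.916 * M ≤ s.received 0 + s.received 1 ∧
      ∀ i : Fin 2, 1.748 * (1 - s.remaining i - s.received i) ≤
        s.received i.rev + 0.916 * (s.received i + (1 - s.remaining i.rev) - M)
  | some i => s.received i + s.remaining i = 1 / 2 ∧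
      1.748 * (1 / 2) ≤
        s.received i.rev + 0.916 * (s.received i + (1 - s.remaining i.rev) - M)

lemma max_le_self_add_rev {a : Fin 2 → ℝ} (ha : ∀ i, 0 ≤ a i) (i : Fin 2) :
    max (a 0) (a 1) ≤ a i + a i.rev := by
  have := ha 0
  have := ha 1
  fin_cases i <;> simp [Fin.rev, *]

lemma WelfareBound.update {s : GuardState} {M : ℝ} (h : WelfareBound s M) {a : Fin 2 → ℝ}
    (ha : ∀ i, 0 ≤ a i) :
    WelfareBound (guardedUpdate 2.7 s a) (M + max (a 0) (a 1)) := by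
  obtain ⟨b1, b2⟩ := share_bounds ha
  have rev_ne (i : Fin 2) : i.rev ≠ i := by decide +revert
  rcases hs : s.guarded with _ | i
  · simp only [WelfareBound, hs] at h
    obtain ⟨h1, h2⟩ := h
    rcases hg : newlyGuarded 2.7 s a with _ | i
    · simp only [WelfareBound, guardedUpdate, guardedAllocate, hs, hg]
      exact ⟨by linarith, fun i => by linarith [b2 i, h2 i]⟩
    · simp only [WelfareBound, guardedUpdate, guardedAllocate, hs, hg, if_true,
        if_neg (rev_ne i)]
      obtain ⟨f0, f1, f2⟩ := criticalTime_mem_of_newlyGuarded hg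
      set f := criticalTime 2.7 s a i
      -- The item is split at f: the first part obeys the poly-proportional bound scaled by f, the
      -- rest goes to i. Being critical (`f2`) says that the loss of i is then 1 / 2.
      have c1 := mul_le_mul_of_nonneg_left (b2 i) f0
      have c2 := mul_le_mul_of_nonneg_left (max_le_self_add_rev ha i) (sub_nonneg.2 f1)
      exact ⟨by linarith, by linarith [h2 i]⟩
  · simp only [WelfareBound, hs] at h
    obtain ⟨h1, h2⟩ := h
    simp only [WelfareBound, guardedUpdate, guardedAllocate, hs, if_true, if_neg (rev_ne i)]
    exact ⟨by linarith, by linarith [max_le_self_add_rev ha i]⟩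

/-! ### Complete runs and the offline optimum -/

section Run

variable {T : ℕ} (v : Fin 2 → Fin T → ℝ)

lemma stateAt_succ (A : OnlineAlgorithm) {k : ℕ} (hk : k < T) :
    A.stateAt v (k + 1) = A.update (A.stateAt v k) fun i => v i ⟨k, hk⟩ := by
  simp [OnlineAlgorithm.stateAt, hk]

lemma stateAt_received_remaining (p : ℝ) {k : ℕ} (hk : k ≤ T) (j : Fin 2) :
    ((guardedPolyProportional p).stateAt v k).received j =
        ∑ t : Fin k, v j (t.castLE hk) * (guardedPolyProportional p).output v j (t.castLE hk) ∧
      ((guardedPolyProportional p).stateAt v k).remaining j =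
        1 - ∑ t : Fin k, v j (t.castLE hk) := by
  induction k with
  | zero => simp [OnlineAlgorithm.stateAt, guardedPolyProportional]
  | succ k ih =>
    obtain ⟨h1, h2⟩ := ih (by omega)
    rw [stateAt_succ v _ hk, Fin.sum_univ_castSucc, Fin.sum_univ_castSucc]
    constructor
    · rw [mul_comm (v j _)]
      exact congrArg (· + _) h1
    · rw [← sub_sub]
      exact congrArg (· - _) h2

lemma welfareBound_stateAt (hv : ∀ i t, 0 ≤ v i t) {k : ℕ} (hk : k ≤ T) :
    WelfareBound ((guardedPolyProportional 2.7).stateAt v k)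
      (∑ t : Fin k, max (v 0 (t.castLE hk)) (v 1 (t.castLE hk))) := by
  induction k with
  | zero =>
    simp only [WelfareBound, OnlineAlgorithm.stateAt, guardedPolyProportional]
    norm_num
  | succ k ih =>
    rw [stateAt_succ v _ hk, Fin.sum_univ_castSucc]
    exact (ih (by omega)).update fun i => hv i _

/-- The largest welfare is at most the sum of the larger values of the items. -/
lemma optWelfare_le (hv : ∀ i t, 0 ≤ v i t) :
    optWelfare v ≤ ∑ t, max (v 0 t) (v 1 t) ∧
      BddAbove {w | ∃ x : Fin 2 → Fin T → ℝ, IsFeasible x ∧ w = socialWelfare v x} := by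
  have bound : ∀ w ∈ {w | ∃ x : Fin 2 → Fin T → ℝ, IsFeasible x ∧ w = socialWelfare v x},
      w ≤ ∑ t, max (v 0 t) (v 1 t) := by
    rintro w ⟨x, ⟨hx0, hx1⟩, rfl⟩
    simp only [socialWelfare, utility, Fin.sum_univ_two, ← Finset.sum_add_distrib]
    refine Finset.sum_le_sum fun t _ => ?_
    have hs := hx1 t
    rw [Fin.sum_univ_two] at hs
    have m0 : v 0 t ≤ max (v 0 t) (v 1 t) := le_max_left _ _
    have m1 : v 1 t ≤ max (v 0 t) (v 1 t) := le_max_right _ _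
    calc v 0 t * x 0 t + v 1 t * x 1 t
        ≤ max (v 0 t) (v 1 t) * x 0 t + max (v 0 t) (v 1 t) * x 1 t :=
          add_le_add (mul_le_mul_of_nonneg_right m0 (hx0 0 t))
            (mul_le_mul_of_nonneg_right m1 (hx0 1 t))
      _ = max (v 0 t) (v 1 t) * (x 0 t + x 1 t) := by ring
      _ ≤ max (v 0 t) (v 1 t) := mul_le_of_le_one_right ((hv 0 t).trans m0) hs
  refine ⟨csSup_le ⟨_, fun _ _ => 0, ⟨fun _ _ => le_rfl, fun _ => by simp⟩, rfl⟩ bound,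
    _, bound⟩

/-- Giving everything to agent 0 yields welfare 1; this makes the denominator of the ratio positive.
-/
lemma one_le_optWelfare (hv : IsInstance v) : 1 ≤ optWelfare v := by
  refine le_csSup (optWelfare_le v hv.1).2 ⟨fun i _ => if i = 0 then 1 else 0, ⟨?_, ?_⟩, ?_⟩
  · intro i t
    dsimp only
    split_ifs <;> norm_num
  · simp
  · simp [socialWelfare, utility, hv.2 0]

end Run

end OnlineDivision

open OnlineDivision in
theorem mainTheorem1 :
    (OnlineDivision.guardedPolyProportional (2.7 : ℝ)).IsApproximation (0.916 : ℝ) := by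
  intro T v hv
  refine ⟨⟨fun i t => guardedAllocate_nonneg (fun j => hv.1 j t) i,
    fun t => sum_guardedAllocate_le_one _ _ _⟩, ?_⟩
  have hpos : 0 < optWelfare v := one_pos.trans_le (one_le_optWelfare v hv)
  rw [le_div_iff₀ hpos]
  have hopt := (optWelfare_le v hv.1).1
  have hrec : ∀ j, ((guardedPolyProportional 2.7).stateAt v T).received j =
      utility v ((guardedPolyProportional 2.7).output v) j := fun j =>
    (stateAt_received_remaining v 2.7 le_rfl j).1
  have hrem : ∀ j, ((guardedPolyProportional 2.7).stateAt v T).remaining j = 0 := fun j =>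
    (stateAt_received_remaining v 2.7 le_rfl j).2.trans (sub_eq_zero.2 (hv.2 j).symm)
  have key : WelfareBound ((guardedPolyProportional 2.7).stateAt v T)
      (∑ t, max (v 0 t) (v 1 t)) := welfareBound_stateAt v hv.1 le_rfl
  rw [socialWelfare, Fin.sum_univ_two]
  rcases hs : ((guardedPolyProportional 2.7).stateAt v T).guarded with _ | i
  · simp only [WelfareBound, hs, hrec] at key
    linarith [key.1]
  · simp only [WelfareBound, hs, hrec, hrem] at key
    obtain ⟨k1, k2⟩ := key
    have : utility v ((guardedPolyProportional 2.7).output v) 0 +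
        utility v ((guardedPolyProportional 2.7).output v) 1 =
        utility v ((guardedPolyProportional 2.7).output v) i +
        utility v ((guardedPolyProportional 2.7).output v) i.rev := by
      fin_cases i
      · rfl
      · exact add_comm _ _
    rw [this]
    -- With utility 1 / 2 for i, this is 1.748 / 2 = 1.5 * 0.916 - 1 / 2.
    linarith
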